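/- Let $G$ be a group generated as a monoid by a finite set $S$, where each $s\in S$ has a weight $\omega(s)\in\{1,2,3,\ldots\}$. For a word $\sigma=\sigma_1\cdots\sigma_q\in S^*$ let $|\sigma|_S=q$ be its length, $\overline{\sigma}\in G$ the element that it represents and $\omega(\sigma)=\sum_i\omega(\sigma_i)$ its weight; $\sigma$ is a geodesic if no word in $S^*$ representing $\overline\sigma$ has smaller weight. Let $N\trianglelefteq G$ be a normal subgroup of finite index $d$ that is isomorphic to $\mathbb{Z}^n$ for some $n\ge 0$ (so $G$ is virtually abelian), and let $T\ni 1$ be a set of coset representatives for $N$ in $G$; every $g\in G$ is uniquely $g=z\cdot\rho(g)$ with $z\in N$ and $\rho(g)\in T$. Put $$Y=\{\sigma\in S^*\mid 1\le|\sigma|_S\le d,\ \overline\sigma\in N\},\qquad P=\{\sigma\in S^*\mid 1\le|\sigma|_S\le d-1,\ \overline\sigma\notin N\},$$ and fix a labelling $Y=\{y_1,\ldots,y_m\}$ with $m=|Y|$. A pattern is a word $\pi=\pi_1\pi_2\cdots\pi_k\in P^*$ in the letters of $P$, with $0\le k\le d$, such that $\rho(\overline{\pi_1\cdots\pi_i})$,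 $0\le i\le k-1$, are pairwise distinct. For $v\in\mathbb{N}^{(k+1)m}$ (where $0\in\mathbb{N}$) the patterned word $v^\pi\in S^*$ is $$v^\pi=\big(y_1^{v_1}\cdots y_m^{v_m}\big)\,\pi_1\,\big(y_1^{v_{m+1}}\cdots y_m^{v_{2m}}\big)\,\pi_2\cdots\pi_k\,\big(y_1^{v_{km+1}}\cdots y_m^{v_{(k+1)m}}\big).$$ An elementary region of $\mathbb{Z}^r$ is a set of the form $\{z\mid a\cdot z=b\}$, $\{z\mid a\cdot z>b\}$ or $\{z\mid a\cdot z\equiv b\ (\mathrm{mod}\ c)\}$ with $a\in\mathbb{Z}^r$, $b,c\in\mathbb{Z}$, $c>0$; a basic polyhedral set is a finite intersection of elementary regions, and a polyhedral set is a finite disjoint union of basic polyhedral sets. Lemma. For each pattern $\pi=\pi_1\cdots\pi_k$ there is a polyhedral set $\mathcal{G}_\pi\subseteq\mathbb{Z}^{(k+1)m}$ with $\mathcal{G}_\pi\subseteq\mathbb{N}^{(k+1)m}$ such that, for each $v\in\mathbb{N}^{(k+1)m}$, we have $v\in\mathcal{G}_\pi$ if and only if the word $v^\pi$ is a geodesic.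 -/

import Mathlib

namespace VirtAb

section Polyhedral

/-- An elementary region of `ℤ^r`: the solution set of one equation, strict inequality or
congruence with integer coefficients. -/
def IsElementaryRegion {r : ℕ} (E : Set (Fin r → ℤ)) : Prop :=
  ∃ (a : Fin r → ℤ) (b : ℤ),
    E = {z | a ⬝ᵥ z = b} ∨ E = {z | a ⬝ᵥ z > b} ∨
      ∃ c : ℤ, 0 < c ∧ E = {z | a ⬝ᵥ z ≡ b [ZMOD c]}

/-- A basic polyhedral set: a finite intersection of elementary regions. -/
def IsBasicPolyhedral {r : ℕ} (B : Set (Fin r → ℤ)) : Prop :=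
  ∃ F : Set (Set (Fin r → ℤ)), F.Finite ∧ (∀ E ∈ F, IsElementaryRegion E) ∧ B = ⋂₀ F

/-- A polyhedral set: a finite disjoint union of basic polyhedral sets. -/
def IsPolyhedral {r : ℕ} (Q : Set (Fin r → ℤ)) : Prop :=
  ∃ F : Set (Set (Fin r → ℤ)),
    F.Finite ∧ (∀ B ∈ F, IsBasicPolyhedral B) ∧ F.PairwiseDisjoint id ∧ Q = ⋃₀ F

/-- The subset `ℕ^r` of `ℤ^r`. -/
def natVectors (r : ℕ) : Set (Fin r → ℤ) := {z | ∀ i, 0 ≤ z i}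

end Polyhedral

section Words

variable {G : Type*} [Group G] {S : Set G}

/-- The group element represented by a word in the letters of `S`. -/
def eval (σ : List S) : G := (σ.map Subtype.val).prod

/-- The weight of a word. -/
def weight (ω : S → ℕ) (σ : List S) : ℕ := (σ.map ω).sum

/-- The weighted length of a group element: the least weight of a word representing it. -/
noncomputable def weightedLength (ω : S → ℕ) (g : G) : ℕ :=
  sInf {k | ∃ σ : List S, eval σ = g ∧ weight ω σ = k}

/-- A word is a geodesic if it represents its group element with minimal weight. -/
def IsGeodesic (ω : S → ℕ) (σ : List S) : Prop :=
  weight ω σ = weightedLength ω (eval σ)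

end Words

section Patterns

variable {G : Type*} [Group G]

/-- The representative `t ∈ T` in the normal form `g = z * t` with `z ∈ N` and `t ∈ T`. -/
noncomputable def rho {N : Subgroup G} {T : Set G}
    (hT : Subgroup.IsComplement (N : Set G) T) (g : G) : T :=
  (hT.equiv g).2

/-- The set `Y` of words of length between `1` and `[G : N]` representing an element of `N`. -/
def wordsY (S : Set G) (N : Subgroup G) : Set (List S) :=
  {σ | 1 ≤ σ.length ∧ σ.length ≤ N.index ∧ eval σ ∈ N}

/-- The set `P` of words of length between `1` and `[G : N] - 1` representing an element
outside `N`. -/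
def wordsP (S : Set G) (N : Subgroup G) : Set (List S) :=
  {σ | 1 ≤ σ.length ∧ σ.length ≤ N.index - 1 ∧ eval σ ∉ N}

/-- The word in the letters of `S` spelled by a word in the letters of `P`. -/
def spell {S : Set G} {N : Subgroup G} (π : List (wordsP S N)) : List S :=
  (π.map Subtype.val).flatten

/-- Patterns: words of length at most `[G : N]` in the letters of `P` whose proper prefixes lie
in pairwise distinct cosets. -/
def IsPattern {S : Set G} {N : Subgroup G} {T : Set G}
    (hT : Subgroup.IsComplement (N : Set G) T) (π : List (wordsP S N)) : Prop :=
  π.length ≤ N.index ∧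
    ∀ i < π.length, ∀ j < π.length,
      rho hT (eval (spell (π.take i))) = rho hT (eval (spell (π.take j))) → i = j

/-- The word `y₁ ^ u₁ ⋯ yₘ ^ uₘ`. -/
def powerWord {S : Set G} {N : Subgroup G} {m : ℕ} (y : Fin m ≃ wordsY S N)
    (u : Fin m → ℕ) : List S :=
  (List.ofFn fun i => (List.replicate (u i) (y i : List S)).flatten).flatten

/-- The `j`-th block `(v_{jm+1}, …, v_{jm+m})`, for `0 ≤ j ≤ k`, of a vector
`v ∈ ℕ^{(k+1)m}`. -/
def block {k m : ℕ} (v : Fin ((k + 1) * m) → ℕ) (j : Fin (k + 1)) : Fin m → ℕ :=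
  fun i => v (finProdFinEquiv (j, i))

/-- The word `v ^ π`: the power words of the successive blocks of `v`, separated by the letters
of `π`. -/
def patternedWord {S : Set G} {N : Subgroup G} {m : ℕ} (y : Fin m ≃ wordsY S N)
    (π : List (wordsP S N)) (v : Fin ((π.length + 1) * m) → ℕ) : List S :=
  powerWord y (block v 0) ++
    (List.ofFn fun j : Fin π.length =>
      (π.get j : List S) ++ powerWord y (block v j.succ)).flatten

end Patterns

end VirtAb

namespace VirtAb

/-! ### Boolean operations on polyhedral sets. -/

section Polyhedral

variable {r : ℕ}

/-! Moving a word of `Y` to the front of a word conjugates its value by the prefix it passes. As `N`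
is abelian, this conjugation depends only on the coset of the prefix. Hence, up to the constants
coming from `π`, the value and weight of `v ^ π` are an additive function of `v` with values in `N ×
ℤ` (`totalContribution`).

Cutting out loops in the path of cosets shows that every word has the value and weight of a word
following some pattern (`exists_pattern`). So `v ^ π` fails to be geodesic exactly when one of the
finitely many patterns `π'` offers the same value at smaller weight. For fixed `π'` these `v` form
the preimage of a linear set under `totalContribution`, or the empty set
(`isSemilinearSet_improvable`). Semilinear sets are closed under preimages, finite unions and
complements in `ℕ^r`, so the geodesic vectors are semilinear. Finally, semilinear subsets of `ℤ^r`
are polyhedral (`IsSemilinearSet.isPolyhedral`). -/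

theorem IsElementaryRegion.isBasicPolyhedral {E : Set (Fin r → ℤ)} (hE : IsElementaryRegion E) :
    IsBasicPolyhedral E :=
  ⟨{E}, by simp, by simpa using hE, by simp⟩

theorem IsBasicPolyhedral.univ : IsBasicPolyhedral (Set.univ : Set (Fin r → ℤ)) :=
  ⟨∅, by simp⟩

theorem IsBasicPolyhedral.inter {A B : Set (Fin r → ℤ)} (hA : IsBasicPolyhedral A)
    (hB : IsBasicPolyhedral B) : IsBasicPolyhedral (A ∩ B) := by
  obtain ⟨F, hF, hF', rfl⟩ := hA
  obtain ⟨F₂, hF₂, hF₂', rfl⟩ := hB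
  exact ⟨F ∪ F₂, hF.union hF₂, fun E hE => hE.elim (hF' E) (hF₂' E), Set.sInter_union _ _ |>.symm⟩

theorem IsBasicPolyhedral.iInter {ι : Type*} [Finite ι] {B : ι → Set (Fin r → ℤ)}
    (hB : ∀ i, IsBasicPolyhedral (B i)) : IsBasicPolyhedral (⋂ i, B i) := by
  choose F hF hF' hF'' using hB
  refine ⟨⋃ i, F i, Set.finite_iUnion hF, fun E hE => ?_, ?_⟩
  · obtain ⟨i, hi⟩ := Set.mem_iUnion.1 hE
    exact hF' i E hi
  · simp_rw [hF'', Set.sInter_iUnion]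

theorem IsBasicPolyhedral.isPolyhedral {B : Set (Fin r → ℤ)} (hB : IsBasicPolyhedral B) :
    IsPolyhedral B :=
  ⟨{B}, by simp, by simpa using hB, by simp, by simp⟩

theorem IsPolyhedral.empty : IsPolyhedral (∅ : Set (Fin r → ℤ)) :=
  ⟨∅, by simp⟩

theorem IsPolyhedral.disjoint_union {A B : Set (Fin r → ℤ)} (hA : IsPolyhedral A)
    (hB : IsPolyhedral B) (hAB : Disjoint A B) : IsPolyhedral (A ∪ B) := by
  obtain ⟨F, hF, hF', hFd, rfl⟩ := hA
  obtain ⟨F₂, hF₂, hF₂', hFd₂, rfl⟩ := hB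
  refine ⟨F ∪ F₂, hF.union hF₂, fun E hE => hE.elim (hF' E) (hF₂' E), ?_,
    Set.sUnion_union _ _ |>.symm⟩
  rw [Set.pairwiseDisjoint_union]
  exact ⟨hFd, hFd₂, fun a ha b hb _ =>
    hAB.mono (Set.subset_sUnion_of_mem ha) (Set.subset_sUnion_of_mem hb)⟩

theorem IsPolyhedral.iUnion_of_pairwise_disjoint {ι : Type*} [Finite ι] {A : ι → Set (Fin r → ℤ)}
    (hA : ∀ i, IsPolyhedral (A i)) (hd : Pairwise (Function.onFun Disjoint A)) :
    IsPolyhedral (⋃ i, A i) := by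
  choose F hF hF' hFd hFe using hA
  refine ⟨⋃ i, F i, Set.finite_iUnion hF, fun E hE => ?_, ?_, ?_⟩
  · obtain ⟨i, hi⟩ := Set.mem_iUnion.1 hE
    exact hF' i E hi
  · intro a ha b hb hab
    obtain ⟨i, hi⟩ := Set.mem_iUnion.1 ha
    obtain ⟨j, hj⟩ := Set.mem_iUnion.1 hb
    by_cases hij : i = j
    · subst hij
      exact hFd i hi hj hab
    · refine (hd hij).mono ?_ ?_
      · rw [hFe]; exact Set.subset_sUnion_of_mem hi
      · rw [hFe]; exact Set.subset_sUnion_of_mem hj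
  · rw [Set.sUnion_iUnion]
    exact Set.iUnion_congr hFe

/-- The pairwise intersections of the pieces of two disjoint decompositions are again pairwise
disjoint. -/
theorem IsPolyhedral.inter {A B : Set (Fin r → ℤ)} (hA : IsPolyhedral A) (hB : IsPolyhedral B) :
    IsPolyhedral (A ∩ B) := by
  obtain ⟨F, hF, hF', hFd, rfl⟩ := hA
  obtain ⟨F₂, hF₂, hF₂', hFd₂, rfl⟩ := hB
  have : Finite F := hF
  have : Finite F₂ := hF₂
  have h : ⋃₀ F ∩ ⋃₀ F₂ = ⋃ p : F × F₂, (p.1 : Set (Fin r → ℤ)) ∩ p.2 := by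
    ext z
    simp only [Set.mem_inter_iff, Set.mem_sUnion, Set.mem_iUnion, Prod.exists, Subtype.exists]
    grind
  rw [h]
  refine .iUnion_of_pairwise_disjoint
    (fun p => ((hF' _ p.1.2).inter (hF₂' _ p.2.2)).isPolyhedral) fun p q hpq => ?_
  by_cases h₁ : p.1 = q.1
  · have h₂ : (p.2 : Set (Fin r → ℤ)) ≠ q.2 := fun h₂ => hpq (Prod.ext h₁ (Subtype.ext h₂))
    exact (hFd₂ p.2.2 q.2.2 h₂).mono Set.inter_subset_right Set.inter_subset_right
  · have h₂ : (p.1 : Set (Fin r → ℤ)) ≠ q.1 := fun h => h₁ (Subtype.ext h)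
    exact (hFd p.1.2 q.1.2 h₂).mono Set.inter_subset_left Set.inter_subset_left

theorem isBasicPolyhedral_eq (a : Fin r → ℤ) (b : ℤ) : IsBasicPolyhedral {z | a ⬝ᵥ z = b} :=
  IsElementaryRegion.isBasicPolyhedral ⟨a, b, .inl rfl⟩

theorem isBasicPolyhedral_gt (a : Fin r → ℤ) (b : ℤ) : IsBasicPolyhedral {z | a ⬝ᵥ z > b} :=
  IsElementaryRegion.isBasicPolyhedral ⟨a, b, .inr (.inl rfl)⟩

theorem isBasicPolyhedral_modEq (a : Fin r → ℤ) (b : ℤ) {c : ℤ} (hc : 0 < c) :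
    IsBasicPolyhedral {z | a ⬝ᵥ z ≡ b [ZMOD c]} :=
  IsElementaryRegion.isBasicPolyhedral ⟨a, b, .inr (.inr ⟨c, hc, rfl⟩)⟩

theorem isBasicPolyhedral_ge (a : Fin r → ℤ) (b : ℤ) : IsBasicPolyhedral {z | b ≤ a ⬝ᵥ z} := by
  simpa [Int.sub_one_lt_iff] using isBasicPolyhedral_gt a (b - 1)

theorem isBasicPolyhedral_le (a : Fin r → ℤ) (b : ℤ) : IsBasicPolyhedral {z | a ⬝ᵥ z ≤ b} := by
  simpa using isBasicPolyhedral_ge (-a) (-b)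

theorem IsElementaryRegion.isPolyhedral_compl {E : Set (Fin r → ℤ)} (hE : IsElementaryRegion E) :
    IsPolyhedral Eᶜ := by
  obtain ⟨a, b, rfl | rfl | ⟨c, hc, rfl⟩⟩ := hE
  · convert! (isBasicPolyhedral_ge a (b + 1)).isPolyhedral.disjoint_union
      (isBasicPolyhedral_le a (b - 1)).isPolyhedral ?_ using 1
    · ext z
      simp only [Set.mem_compl_iff, Set.mem_ofPred_eq, Set.mem_union]
      omega
    · rw [Set.disjoint_left]
      intro z
      simp only [Set.mem_ofPred_eq]
      omega
  · convert! (isBasicPolyhedral_le a b).isPolyhedral using 1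
    ext z
    simp
  -- The complement of a residue class is the union of the other classes modulo `c`.
  · have h : {z | a ⬝ᵥ z ≡ b [ZMOD c]}ᶜ =
        ⋃ i : {i : Set.Ico 0 c // (i : ℤ) ≠ b % c}, {z | a ⬝ᵥ z ≡ (i : ℤ) [ZMOD c]} := by
      ext z
      simp only [Set.mem_compl_iff, Set.mem_ofPred_eq, Set.mem_iUnion, Subtype.exists]
      constructor
      · intro hz
        exact ⟨a ⬝ᵥ z % c, ⟨Int.emod_nonneg _ hc.ne', Int.emod_lt_of_pos _ hc⟩, hz,
          (Int.mod_modEq _ _).symm⟩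
      · rintro ⟨i, hi, hne, hz⟩ hz'
        refine hne ?_
        rw [← hz', hz, Int.emod_eq_of_lt hi.1 hi.2]
    rw [h]
    refine .iUnion_of_pairwise_disjoint (fun i => (isBasicPolyhedral_modEq a _ hc).isPolyhedral) ?_
    intro i j hij
    rw [Function.onFun, Set.disjoint_left]
    intro z (hi : _ % _ = _ % _) (hj : _ % _ = _ % _)
    refine hij (Subtype.ext (Subtype.ext ?_))
    rw [hi, Int.emod_eq_of_lt i.1.2.1 i.1.2.2, Int.emod_eq_of_lt j.1.2.1 j.1.2.2] at hj
    exact hj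

theorem IsBasicPolyhedral.isPolyhedral_compl {B : Set (Fin r → ℤ)} (hB : IsBasicPolyhedral B) :
    IsPolyhedral Bᶜ := by
  obtain ⟨F, hF, hF', rfl⟩ := hB
  induction F, hF using Set.Finite.induction_on with
  | empty => simpa using IsPolyhedral.empty
  | @insert E F _ _ ih =>
    rw [Set.forall_mem_insert] at hF'
    -- Intersecting with `E` makes the union in De Morgan's law disjoint.
    have h : (⋂₀ insert E F)ᶜ = Eᶜ ∪ (E ∩ (⋂₀ F)ᶜ) := by
      ext z
      simp only [Set.sInter_insert, Set.mem_compl_iff, Set.mem_inter_iff, Set.mem_union]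
      tauto
    rw [h]
    exact hF'.1.isPolyhedral_compl.disjoint_union
      (hF'.1.isBasicPolyhedral.isPolyhedral.inter (ih hF'.2))
      (disjoint_compl_left.mono_right Set.inter_subset_left)

theorem IsPolyhedral.compl {A : Set (Fin r → ℤ)} (hA : IsPolyhedral A) : IsPolyhedral Aᶜ := by
  obtain ⟨F, hF, hF', -, rfl⟩ := hA
  induction F, hF using Set.Finite.induction_on with
  | empty => simpa using IsBasicPolyhedral.univ.isPolyhedral
  | insert _ _ ih =>
    rw [Set.forall_mem_insert] at hF'
    rw [Set.sUnion_insert, Set.compl_union]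
    exact hF'.1.isPolyhedral_compl.inter (ih hF'.2)

theorem IsPolyhedral.union {A B : Set (Fin r → ℤ)} (hA : IsPolyhedral A) (hB : IsPolyhedral B) :
    IsPolyhedral (A ∪ B) := by
  simpa [Set.compl_inter] using (hA.compl.inter hB.compl).compl

theorem IsPolyhedral.sUnion {F : Set (Set (Fin r → ℤ))} (hF : F.Finite)
    (hF' : ∀ A ∈ F, IsPolyhedral A) : IsPolyhedral (⋃₀ F) := by
  induction F, hF using Set.Finite.induction_on with
  | empty => simpa using IsPolyhedral.empty
  | insert _ _ ih =>
    rw [Set.forall_mem_insert] at hF'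
    rw [Set.sUnion_insert]
    exact hF'.1.union (ih hF'.2)

/-! ### Semilinear subsets of `ℤ^r` are polyhedral. -/

open Matrix in
/-- An injective integer matrix has a left inverse up to a positive integer multiple. -/
theorem exists_mul_eq_smul_one {m n : Type*} [Fintype m] [Fintype n] [DecidableEq n]
    (A : Matrix m n ℤ) (hA : ∀ v, A *ᵥ v = 0 → v = 0) :
    ∃ (L : Matrix n m ℤ) (D : ℤ), 0 < D ∧ L * A = D • 1 := by
  have hD : (Aᵀ * A).det ≠ 0 := by
    intro h
    obtain ⟨v, hv, h⟩ := Matrix.exists_mulVec_eq_zero_iff.2 h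
    -- A kernel vector `v` of the Gram matrix satisfies `Av · Av = 0`.
    refine hv (hA v (dotProduct_self_eq_zero.1 ?_))
    rw [Matrix.dotProduct_mulVec, ← Matrix.mulVec_transpose, Matrix.mulVec_mulVec, h,
      zero_dotProduct]
  -- The adjugate gives the multiple `det`; the extra factor makes it the positive number `det ^ 2`.
  refine ⟨(Aᵀ * A).det • ((Aᵀ * A).adjugate * Aᵀ), (Aᵀ * A).det * (Aᵀ * A).det,
    mul_self_pos.2 hD, ?_⟩
  rw [Matrix.smul_mul, Matrix.mul_assoc, Matrix.adjugate_mul, smul_smul]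

open Matrix Pointwise in
-- Let the columns of `A` be the independent periods and `L * A = D • 1`. Then `w = A c` with `c` a
-- vector of naturals iff `L w ≥ 0`, `D ∣ L w` and `A L w = D w`: inequalities, congruences and
-- equations.
theorem _root_.IsProperLinearSet.isBasicPolyhedral {s : Set (Fin r → ℤ)}
    (hs : IsProperLinearSet s) : IsBasicPolyhedral s := by
  classical
  rw [isProperLinearSet_iff] at hs
  obtain ⟨a, t, ht, rfl⟩ := hs
  let A : Matrix (Fin r) t ℤ := Matrix.of fun i p => (p : Fin r → ℤ) i
  have hAv : ∀ v : t → ℤ, A *ᵥ v = ∑ p : t, v p • (p : Fin r → ℤ) := by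
    intro v
    ext i
    simp [A, Matrix.mulVec, dotProduct, mul_comm]
  have hA : ∀ v, A *ᵥ v = 0 → v = 0 := by
    intro v hv
    -- The periods are independent over `ℕ` only; splitting `v` into positive and negative parts
    -- gives injectivity over `ℤ`.
    have key := Fintype.linearIndependent_iffₛ.1 ht (fun p => (v p).toNat) (fun p => (-v p).toNat) ?_
    · ext p
      have := key p
      simp only [Pi.zero_apply]
      omega
    · rw [hAv] at hv
      rw [← sub_eq_zero, ← Finset.sum_sub_distrib, ← hv]
      refine Finset.sum_congr rfl fun p _ => ?_
      simp only [id_eq, ← natCast_zsmul, ← sub_smul, Int.toNat_sub_toNat_neg]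
  obtain ⟨L, D, hD, hLA⟩ := exists_mul_eq_smul_one A hA
  let B : Matrix (Fin r) (Fin r) ℤ := A * L - D • 1
  have hmem : (a +ᵥ (AddSubmonoid.closure (t : Set (Fin r → ℤ)) : Set (Fin r → ℤ))) =
      ((⋂ p, {z | (L *ᵥ a) p ≤ L p ⬝ᵥ z}) ∩ (⋂ p, {z | L p ⬝ᵥ z ≡ (L *ᵥ a) p [ZMOD D]})) ∩
        ⋂ i, {z | B i ⬝ᵥ z = (B *ᵥ a) i} := by
    ext z
    obtain ⟨w, rfl⟩ : ∃ w, z = a + w := ⟨z - a, by simp⟩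
    simp only [Set.vadd_mem_vadd_set_iff, ← vadd_eq_add a w, SetLike.mem_coe]
    have h₁ : w ∈ AddSubmonoid.closure (t : Set (Fin r → ℤ)) ↔
        ∃ c : t → ℕ, w = A *ᵥ (fun p => (c p : ℤ)) := by
      rw [AddSubmonoid.mem_closure_iff_of_fintype]
      simp [hAv]
    rw [h₁]
    simp only [vadd_eq_add, Set.mem_inter_iff, Set.mem_iInter, Set.mem_ofPred_eq, dotProduct_add]
    have e₁ : ∀ p, L p ⬝ᵥ a = (L *ᵥ a) p := fun p => rfl
    have e₂ : ∀ p, L p ⬝ᵥ w = (L *ᵥ w) p := fun p => rfl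
    have e₃ : ∀ i, B i ⬝ᵥ a = (B *ᵥ a) i := fun p => rfl
    have e₄ : ∀ i, B i ⬝ᵥ w = (A *ᵥ (L *ᵥ w)) i - D * w i := fun p => by
      change (B *ᵥ w) p = _
      simp [B, Matrix.sub_mulVec]
    simp only [e₁, e₂, e₃, e₄, le_add_iff_nonneg_right, add_eq_left, sub_eq_zero]
    have e₅ : ∀ p, ((L *ᵥ a) p + (L *ᵥ w) p ≡ (L *ᵥ a) p [ZMOD D] ↔ D ∣ (L *ᵥ w) p) := fun p => by
      rw [Int.modEq_comm, Int.modEq_iff_dvd]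
      simp
    simp only [e₅]
    constructor
    · rintro ⟨c, rfl⟩
      have : L *ᵥ (A *ᵥ fun p => (c p : ℤ)) = D • fun p => (c p : ℤ) := by
        rw [Matrix.mulVec_mulVec, hLA, Matrix.smul_mulVec, Matrix.one_mulVec]
      rw [this]
      refine ⟨⟨fun p => by simp; positivity, fun p => by simp⟩, fun i => ?_⟩
      rw [Matrix.mulVec_smul, Pi.smul_apply, smul_eq_mul]
    · rintro ⟨⟨h0, hd⟩, he⟩
      choose c hc using hd
      have hc0 : ∀ p, 0 ≤ c p := fun p => by
        have := h0 p
        rw [hc] at this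
        exact nonneg_of_mul_nonneg_right this hD
      refine ⟨fun p => (c p).toNat, ?_⟩
      have e : (fun p => (((c p).toNat : ℕ) : ℤ)) = c := funext fun p => Int.toNat_of_nonneg (hc0 p)
      rw [e]
      have : L *ᵥ w = D • c := funext hc
      ext i
      have := he i
      rw [‹L *ᵥ w = _›, Matrix.mulVec_smul] at this
      exact (mul_left_cancel₀ hD.ne' this).symm
  rw [hmem]
  exact ((IsBasicPolyhedral.iInter fun p => isBasicPolyhedral_ge _ _).inter
    (.iInter fun p => isBasicPolyhedral_modEq _ _ hD)).inter
      (.iInter fun i => isBasicPolyhedral_eq _ _)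

theorem _root_.IsSemilinearSet.isPolyhedral {s : Set (Fin r → ℤ)} (hs : IsSemilinearSet s) :
    IsPolyhedral s := by
  obtain ⟨F, hF, hF', rfl⟩ := hs.isProperSemilinearSet
  exact .sUnion hF fun A hA => (hF' A hA).isBasicPolyhedral.isPolyhedral

end Polyhedral

end VirtAb

namespace VirtAb

/-! ### Words, weights and paths without repetition. -/

section Words

variable {G : Type*} {S : Set G}

@[simp]
theorem weight_nil (ω : S → ℕ) : weight ω [] = 0 := rfl

@[simp]
theorem weight_append (ω : S → ℕ) (σ τ : List S) :
    weight ω (σ ++ τ) = weight ω σ + weight ω τ := by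
  simp [weight]

theorem finite_words_of_length_le (hS : S.Finite) (d : ℕ) :
    {σ : List S | σ.length ≤ d}.Finite :=
  have : Finite S := hS
  List.finite_length_le S d

variable [Group G]

@[simp]
theorem eval_nil : eval ([] : List S) = 1 := rfl

@[simp]
theorem eval_append (σ τ : List S) : eval (σ ++ τ) = eval σ * eval τ := by
  simp [eval]

theorem isGeodesic_iff {ω : S → ℕ} {σ : List S} :
    IsGeodesic ω σ ↔ ∀ τ : List S, eval τ = eval σ → weight ω σ ≤ weight ω τ := by
  -- Nonemptiness ensures that `sInf` is attained and is not the default value `0`.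
  have hne : {k | ∃ τ : List S, eval τ = eval σ ∧ weight ω τ = k}.Nonempty := ⟨_, σ, rfl, rfl⟩
  constructor
  · intro h τ hτ
    rw [h]
    exact Nat.sInf_le ⟨τ, hτ, rfl⟩
  · intro h
    obtain ⟨τ, hτ, hk⟩ := Nat.sInf_mem hne
    exact le_antisymm ((h τ hτ).trans_eq hk) (Nat.sInf_le ⟨σ, rfl, rfl⟩)

end Words

section PrefixInjective

variable {α Q : Type*}

/-- The function `f` takes distinct values on the prefixes of the list `l`, `l` included. -/
def PrefixInjective (f : List α → Q) (l : List α) : Prop :=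
  ∀ i ≤ l.length, ∀ j ≤ l.length, f (l.take i) = f (l.take j) → i = j

variable {f : List α → Q} {l : List α}

theorem PrefixInjective.nil : PrefixInjective f [] := by
  intro i hi j hj _
  simp_all

theorem PrefixInjective.take (h : PrefixInjective f l) (n : ℕ) :
    PrefixInjective f (l.take n) := by
  intro i hi j hj hij
  rw [List.length_take, le_min_iff] at hi hj
  rw [List.take_take, List.take_take, min_eq_left hi.1, min_eq_left hj.1] at hij
  exact h i hi.2 j hj.2 hij

theorem PrefixInjective.append_singleton (h : PrefixInjective f l) {a : α}
    (ha : ∀ i ≤ l.length, f (l ++ [a]) ≠ f (l.take i)) : PrefixInjective f (l ++ [a]) := by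
  have key : ∀ i ≤ l.length, (l ++ [a]).take i = l.take i := fun i hi => by
    rw [List.take_append_of_le_length hi]
  have key' : (l ++ [a]).take (l.length + 1) = l ++ [a] := List.take_of_length_le (by simp)
  intro i hi j hj hij
  simp only [List.length_append, List.length_singleton] at hi hj
  rcases Nat.le_succ_iff.1 hi with hi | rfl <;> rcases Nat.le_succ_iff.1 hj with hj | rfl
  · rw [key i hi, key j hj] at hij
    exact h i hi j hj hij
  · rw [key i hi, key'] at hij
    exact absurd hij.symm (ha i hi)
  · rw [key j hj, key'] at hij
    exact absurd hij (ha j hj)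
  · rfl

/-- The inequality is strict because the empty prefix also takes up a value. -/
theorem PrefixInjective.length_lt [Finite Q] (h : PrefixInjective f l) :
    l.length < Nat.card Q := by
  have := Nat.card_le_card_of_injective (fun i : Fin (l.length + 1) => f (l.take i))
    fun i j hij => Fin.ext (h i (Nat.lt_succ_iff.1 i.2) j (Nat.lt_succ_iff.1 j.2) hij)
  simpa using this

end PrefixInjective

/-! ### Patterns, contributions and the reduction of words to patterns. -/

section Patterns

variable {G : Type*} [Group G] {S : Set G} {N : Subgroup G}

@[simp]
theorem spell_nil : spell ([] : List (wordsP S N)) = [] := rfl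

@[simp]
theorem spell_cons (p : wordsP S N) (π : List (wordsP S N)) :
    spell (p :: π) = p.1 ++ spell π := by
  simp [spell]

@[simp]
theorem spell_append (π π' : List (wordsP S N)) : spell (π ++ π') = spell π ++ spell π' := by
  simp [spell]

theorem finite_wordsY (hS : S.Finite) : Finite (wordsY S N) :=
  (finite_words_of_length_le hS N.index).subset fun _ h => h.2.1

theorem finite_wordsP (hS : S.Finite) : Finite (wordsP S N) :=
  (finite_words_of_length_le hS (N.index - 1)).subset fun _ h => h.2.1

theorem finite_patterns (hS : S.Finite) {T : Set G} (hT : Subgroup.IsComplement (N : Set G) T) :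
    {π : List (wordsP S N) | IsPattern hT π}.Finite :=
  have := finite_wordsP (N := N) hS
  (List.finite_length_le (wordsP S N) N.index).subset fun _ h => h.1

theorem weight_interleave (ω : S → ℕ) (π : List (wordsP S N))
    (u : Fin (π.length + 1) → List S) :
    weight ω
        (u 0 ++ (List.ofFn fun j : Fin π.length => (π.get j : List S) ++ u j.succ).flatten) =
      ∑ j, weight ω (u j) + weight ω (spell π) := by
  induction π with
  | nil => simp
  | cons p π ih =>
    have := ih fun j => u j.succ
    simp only [List.length_cons] at *
    rw [List.ofFn_succ, List.flatten_cons, Fin.sum_univ_succ, weight_append, List.append_assoc,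
      weight_append]
    simp only [List.get_cons_zero, List.get_cons_succ', Fin.succ_zero_eq_one] at this ⊢
    rw [this]
    simp
    ring

theorem weight_powerWord (ω : S → ℕ) {m : ℕ} (y : Fin m ≃ wordsY S N) (u : Fin m → ℕ) :
    weight ω (powerWord y u) = ∑ i, u i * weight ω (y i).1 := by
  rw [← List.sum_ofFn, powerWord]
  simp only [weight, List.map_flatten, List.sum_flatten, List.map_ofFn]
  congr 2
  ext i
  simp

open scoped IsMulCommutative

theorem eval_powerWord [IsMulCommutative N] {m : ℕ} (y : Fin m ≃ wordsY S N) (u : Fin m → ℕ) :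
    eval (powerWord y u) = ((∏ i, (⟨eval (y i).1, (y i).2.2.2⟩ : N) ^ u i : N) : G) := by
  rw [← List.prod_ofFn, ← Subgroup.coe_subtype, map_list_prod, powerWord]
  simp only [eval, List.map_flatten, List.prod_flatten, List.map_ofFn]
  congr 2
  ext i
  simp

variable [N.Normal]

theorem rho_eq_rho_iff {T : Set G} (hT : Subgroup.IsComplement (N : Set G) T) {g h : G} :
    rho hT g = rho hT h ↔ (g : G ⧸ N) = h := by
  rw [rho, rho, hT.equiv_snd_eq_iff_rightCosetEquivalence, RightCosetEquivalence,
    rightCoset_eq_iff, ← div_eq_mul_inv, ← QuotientGroup.eq_iff_div_mem, eq_comm]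

theorem isPattern_iff {T : Set G} (hT : Subgroup.IsComplement (N : Set G) T)
    {π : List (wordsP S N)} :
    IsPattern hT π ↔ π.length ≤ N.index ∧ ∀ i < π.length, ∀ j < π.length,
      ((eval (spell (π.take i)) : G) : G ⧸ N) = (eval (spell (π.take j)) : G) → i = j := by
  simp only [IsPattern, rho_eq_rho_iff]

/-- The two conjugations differ by one by `g⁻¹ * h ∈ N`, which is trivial on the abelian group `N`.
-/
theorem conjNormal_eq_conjNormal [IsMulCommutative N] {g h : G} (hgh : (g : G ⧸ N) = h) (z : N) :
    MulAut.conjNormal g z = MulAut.conjNormal h z := by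
  have hmem := QuotientGroup.eq.1 hgh
  have hc : (⟨_, hmem⟩ : N) * z = z * ⟨_, hmem⟩ := mul_comm' _ _
  have hc' : g⁻¹ * h * z = z * (g⁻¹ * h) := congrArg Subtype.val hc
  apply Subtype.ext
  simp only [MulAut.conjNormal_apply]
  calc g * z * g⁻¹ = g * (z * (g⁻¹ * h)) * h⁻¹ := by group
    _ = h * z * h⁻¹ := by rw [← hc']; group

/-- The contribution to `N` and to the weight of a word `σ ∈ Y` that is read after a word
representing `g`. -/
def contribution (ω : S → ℕ) (g : G) (σ : wordsY S N) : Additive N × ℤ :=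
  (.ofMul (MulAut.conjNormal g ⟨eval σ.1, σ.2.2.2⟩), weight ω σ.1)

/-- The contribution of a word `σ ∈ Y` that is read after the first `j` letters of `π`. -/
def patternContribution (ω : S → ℕ) (π : List (wordsP S N))
    (p : Fin (π.length + 1) × wordsY S N) : Additive N × ℤ :=
  contribution ω (eval (spell (π.take p.1))) p.2

/-- All possible contributions of the words of `Y` in words that follow the pattern `π`. -/
def contributions (ω : S → ℕ) (π : List (wordsP S N)) : AddSubmonoid (Additive N × ℤ) :=
  AddSubmonoid.closure (Set.range (patternContribution ω π))

theorem contribution_mem_contributions (ω : S → ℕ) (π : List (wordsP S N)) {i : ℕ}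
    (hi : i ≤ π.length) (σ : wordsY S N) :
    contribution ω (eval (spell (π.take i))) σ ∈ contributions ω π :=
  AddSubmonoid.subset_closure ⟨(⟨i, Nat.lt_succ_iff.2 hi⟩, σ), rfl⟩

theorem contributions_le_append (ω : S → ℕ) (π π' : List (wordsP S N)) :
    contributions ω π ≤ contributions ω (π ++ π') := by
  rw [contributions, AddSubmonoid.closure_le]
  rintro _ ⟨⟨i, σ⟩, rfl⟩
  have hi := Nat.lt_succ_iff.1 i.2
  have := contribution_mem_contributions ω (π ++ π') (i := i) (by simp; omega) σ
  rwa [List.take_append_of_le_length hi] at this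

variable [IsMulCommutative N]

/-- Every word has the value and weight of a word that follows a path through pairwise distinct
cosets, decorated with words in `Y`, and then a path through these cosets without repetition. -/
theorem exists_path_and_tail [N.FiniteIndex] (ω : S → ℕ) (σ : List S) :
    ∃ (π : List (wordsP S N)) (τ : List S), ∃ x ∈ contributions ω π,
      eval σ = (x.1.toMul : G) * eval (spell π) * eval τ ∧
      (weight ω σ : ℤ) = x.2 + weight ω (spell π) + weight ω τ ∧
      PrefixInjective (fun π : List (wordsP S N) => ((eval (spell π) : G) : G ⧸ N)) π ∧
      PrefixInjective (fun τ : List S => ((eval τ : G) : G ⧸ N)) τ ∧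
      ∀ j ≤ τ.length, ∃ i ≤ π.length,
        ((eval (spell π) : G) : G ⧸ N) * (eval (τ.take j) : G) = (eval (spell (π.take i)) : G) := by
  induction σ using List.reverseRecOn with
  | nil => exact ⟨[], [], 0, zero_mem _, by simp, by simp, .nil, .nil, by simp⟩
  | append_singleton σ s ih =>
    obtain ⟨π, τ, x, hx, he, hw, hπ, hτ, hτπ⟩ := ih
    -- If the new letter closes a loop in the tail, the loop is a word of `Y`. It starts in a coset
    -- visited by `π`, so it can be recorded as a contribution read at that point of `π`.
    by_cases h₁ : ∃ j ≤ τ.length, ((eval (τ ++ [s]) : G) : G ⧸ N) = (eval (τ.take j) : G)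
    · obtain ⟨j, hj, h₁⟩ := h₁
      have hcut : τ ++ [s] = τ.take j ++ (τ.drop j ++ [s]) := by
        rw [← List.append_assoc, List.take_append_drop]
      have hY : τ.drop j ++ [s] ∈ wordsY S N := by
        refine ⟨by simp, ?_, ?_⟩
        · have : τ.length < N.index := hτ.length_lt
          simp only [List.length_append, List.length_drop, List.length_singleton]
          omega
        · rw [hcut, eval_append, QuotientGroup.mk_mul, mul_eq_left] at h₁
          exact (QuotientGroup.eq_one_iff _).1 h₁
      obtain ⟨i, hi, hij⟩ := hτπ j hj
      refine ⟨π, τ.take j, x + contribution ω (eval (spell (π.take i))) ⟨_, hY⟩,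
        add_mem hx (contribution_mem_contributions ω π hi _), ?_, ?_, hπ, hτ.take j, ?_⟩
      · rw [contribution, conjNormal_eq_conjNormal
          (h := eval (spell π) * eval (τ.take j)) (by rw [QuotientGroup.mk_mul]; exact hij.symm)]
        rw [eval_append, he, mul_assoc, ← eval_append, hcut, eval_append]
        simp only [Prod.fst_add, toMul_add, toMul_ofMul, Subgroup.coe_mul,
          MulAut.conjNormal_apply]
        group
      · have := congrArg (weight ω) hcut
        simp only [weight_append] at this
        simp only [contribution, Prod.snd_add, weight_append]
        push_cast
        zify at this
        linarith
      · intro j' hj'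
        rw [List.length_take, le_min_iff] at hj'
        rw [List.take_take, min_eq_left hj'.1]
        exact hτπ j' hj'.2
    push Not at h₁
    have hτs := hτ.append_singleton h₁
    -- Without a loop, the tail just grows while it stays in cosets visited by `π`. Once it reaches
    -- a new coset, it becomes the next letter of `π` and a new tail begins.
    by_cases h₂ : ∃ i ≤ π.length,
        ((eval (spell π) : G) : G ⧸ N) * (eval (τ ++ [s]) : G) = (eval (spell (π.take i)) : G)
    · refine ⟨π, τ ++ [s], x, hx, ?_, ?_, hπ, hτs, fun j hj => ?_⟩
      · rw [eval_append, eval_append, he, mul_assoc _ (eval τ)]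
      · rw [weight_append, weight_append]
        push_cast
        linarith
      · rw [List.length_append, List.length_singleton] at hj
        rcases Nat.le_succ_iff.1 hj with hj | rfl
        · rw [List.take_append_of_le_length hj]
          exact hτπ j hj
        · rw [List.take_of_length_le (by simp)]
          exact h₂
    · push Not at h₂
      have hP : τ ++ [s] ∈ wordsP S N := by
        refine ⟨by simp, ?_, fun hmem => ?_⟩
        · have : (τ ++ [s]).length < N.index := hτs.length_lt
          omega
        · refine h₁ 0 (Nat.zero_le _) ?_
          simpa using (QuotientGroup.eq_one_iff _).2 hmem
      refine ⟨π ++ [⟨_, hP⟩], [], x, contributions_le_append ω _ _ hx, ?_, ?_,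
        hπ.append_singleton ?_, .nil, fun j hj => ⟨π.length + 1, by simp, ?_⟩⟩
      · simp only [spell_append, spell_cons, spell_nil, eval_append, he, eval_nil]
        group
      · simp only [spell_append, spell_cons, spell_nil, weight_append, weight_nil]
        push_cast
        linarith
      · intro i hi
        simpa using h₂ i hi
      · rw [List.take_of_length_le (l := π ++ _) (by simp)]
        simp

/-- Every word has the value and weight of a word that follows a pattern. -/
theorem exists_pattern [N.FiniteIndex] (ω : S → ℕ) {T : Set G}
    (hT : Subgroup.IsComplement (N : Set G) T) (σ : List S) :
    ∃ π : List (wordsP S N), IsPattern hT π ∧ ∃ x ∈ contributions ω π,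
      eval σ = (x.1.toMul : G) * eval (spell π) ∧
      (weight ω σ : ℤ) = x.2 + weight ω (spell π) := by
  obtain ⟨π, τ, x, hx, he, hw, hπ, hτ, -⟩ := exists_path_and_tail (N := N) ω σ
  have hπd : π.length < N.index := hπ.length_lt
  by_cases h : τ = []
  · subst h
    refine ⟨π, (isPattern_iff hT).2 ⟨hπd.le, fun i hi j hj => hπ i hi.le j hj.le⟩, x, hx, ?_, ?_⟩
    · simpa using he
    · simpa using hw
  · have hlen : 0 < τ.length := List.length_pos_iff.2 h
    have hP : τ ∈ wordsP S N := by
      refine ⟨hlen, ?_, fun hmem => ?_⟩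
      · have : τ.length < N.index := hτ.length_lt
        omega
      · have := hτ 0 (Nat.zero_le _) τ.length le_rfl
        simp only [List.take_zero, eval_nil, List.take_length, QuotientGroup.mk_one] at this
        exact hlen.ne (this ((QuotientGroup.eq_one_iff _).2 hmem).symm)
    -- The leftover tail becomes the last letter. It may return to a visited coset, which is allowed
    -- since patterns constrain only proper prefixes.
    refine ⟨π ++ [⟨τ, hP⟩], (isPattern_iff hT).2 ⟨by simpa using hπd, fun i hi j hj hij => ?_⟩, x,
      contributions_le_append ω _ _ hx, ?_, ?_⟩
    · rw [List.length_append, List.length_singleton, Nat.lt_succ_iff] at hi hj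
      rw [List.take_append_of_le_length hi, List.take_append_of_le_length hj] at hij
      exact hπ i hi j hj hij
    · simp [he, mul_assoc]
    · simp only [spell_append, spell_cons, spell_nil, weight_append, weight_nil]
      push_cast
      linarith

/-- The value of the words `u 0, u 1, …` in `N`, separated by the letters of `π`. -/
theorem eval_interleave (π : List (wordsP S N)) (u : Fin (π.length + 1) → List S)
    (x : Fin (π.length + 1) → N) (hx : ∀ j, eval (u j) = x j) :
    eval (u 0 ++ (List.ofFn fun j : Fin π.length => (π.get j : List S) ++ u j.succ).flatten) =
      ((∏ j : Fin (π.length + 1), MulAut.conjNormal (eval (spell (π.take j))) (x j) : N) : G) * eval (spell π) := by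
  induction π with
  | nil => simpa using hx 0
  | cons p π ih =>
    have := ih (fun j => u j.succ) (fun j => x j.succ) fun j => hx _
    simp only [List.length_cons] at *
    rw [List.ofFn_succ, List.flatten_cons, Fin.prod_univ_succ, eval_append, List.append_assoc,
      eval_append]
    have h : ∀ j : Fin (π.length + 1),
        MulAut.conjNormal (eval (spell ((p :: π).take j.succ))) (x j.succ) =
          MulAut.conjNormal (eval p.1)
            (MulAut.conjNormal (eval (spell (π.take j))) (x j.succ)) := fun j => by
      simp
    simp only [h, ← map_prod]
    simp only [List.get_cons_zero, List.get_cons_succ', Fin.succ_zero_eq_one] at this ⊢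
    rw [this]
    simp only [hx, Subgroup.coe_mul, MulAut.conjNormal_apply, Fin.val_zero, List.take_zero, spell_nil,
      eval_nil, spell_cons, eval_append, one_mul, inv_one, mul_one]
    group

/-- The total contribution of the words of `Y` in `v ^ π`, as a function of `v`. -/
def totalContribution (ω : S → ℕ) {m : ℕ} (y : Fin m ≃ wordsY S N) (π : List (wordsP S N)) :
    (Fin ((π.length + 1) * m) → ℕ) →+ Additive N × ℤ where
  toFun v := ∑ p : Fin (π.length + 1) × Fin m,
    v (finProdFinEquiv p) • patternContribution ω π (p.1, y p.2)
  map_zero' := by simp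
  map_add' := by simp [add_smul, Finset.sum_add_distrib]

theorem totalContribution_apply (ω : S → ℕ) {m : ℕ} (y : Fin m ≃ wordsY S N)
    (π : List (wordsP S N)) (v : Fin ((π.length + 1) * m) → ℕ) :
    totalContribution ω y π v =
      ∑ j, ∑ i, block v j i • patternContribution ω π (j, y i) :=
  Fintype.sum_prod_type _

theorem eval_patternedWord (ω : S → ℕ) {m : ℕ} (y : Fin m ≃ wordsY S N)
    (π : List (wordsP S N)) (v : Fin ((π.length + 1) * m) → ℕ) :
    eval (patternedWord y π v) =
      ((totalContribution ω y π v).1.toMul : G) * eval (spell π) := by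
  rw [patternedWord, eval_interleave π (fun j => powerWord y (block v j)) _
    fun j => eval_powerWord y _, totalContribution_apply]
  simp [patternContribution, contribution, Prod.fst_sum, toMul_sum, -SubmonoidClass.mk_pow]

theorem weight_patternedWord (ω : S → ℕ) {m : ℕ} (y : Fin m ≃ wordsY S N)
    (π : List (wordsP S N)) (v : Fin ((π.length + 1) * m) → ℕ) :
    (weight ω (patternedWord y π v) : ℤ) =
      (totalContribution ω y π v).2 + weight ω (spell π) := by
  rw [patternedWord, weight_interleave ω π (fun j => powerWord y (block v j)),
    totalContribution_apply]
  simp [patternContribution, contribution, Prod.snd_sum, weight_powerWord]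

/-- The multiplicities of the generators in `x` serve as the exponents, so every contribution is
realised by an actual patterned word. -/
theorem exists_totalContribution_eq (ω : S → ℕ) {m : ℕ} (y : Fin m ≃ wordsY S N)
    (π : List (wordsP S N)) {x : Additive N × ℤ} (hx : x ∈ contributions ω π) :
    ∃ v, totalContribution ω y π v = x := by
  have : Fintype (wordsY S N) := .ofEquiv _ y
  obtain ⟨a, rfl⟩ := AddSubmonoid.mem_closure_range_iff_of_fintype.1 hx
  refine ⟨fun q => a ((finProdFinEquiv.symm q).1, y (finProdFinEquiv.symm q).2), ?_⟩
  rw [← ((Equiv.refl _).prodCongr y).sum_comp]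
  simp only [totalContribution, AddMonoidHom.coe_mk, ZeroHom.coe_mk, Equiv.symm_apply_apply]
  rfl

end Patterns

end VirtAb

namespace VirtAb

/-! ### Semilinearity of the set of geodesic vectors. -/

section Geodesics

variable {G : Type*} [Group G] {S : Set G} {N : Subgroup G} [N.Normal]

open scoped IsMulCommutative Pointwise

variable [IsMulCommutative N]

/-- The vectors `v` such that some word following the pattern `π'` has the same value as `v ^ π`
and smaller weight. -/
def improvable (ω : S → ℕ) {m : ℕ} (y : Fin m ≃ wordsY S N) (π π' : List (wordsP S N)) :
    Set (Fin ((π.length + 1) * m) → ℕ) :=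
  {v | ∃ x ∈ contributions ω π',
    (x.1.toMul : G) * eval (spell π') = eval (patternedWord y π v) ∧
    x.2 + weight ω (spell π') < weight ω (patternedWord y π v)}

theorem isSemilinearSet_improvable (hS : S.Finite) (ω : S → ℕ) {m : ℕ} (y : Fin m ≃ wordsY S N)
    (π π' : List (wordsP S N)) : IsSemilinearSet (improvable ω y π π') := by
  by_cases h : eval (spell π) * (eval (spell π'))⁻¹ ∈ N
  · have := finite_wordsY (N := N) hS
    -- The shift `b` compares the constants of `π` and `π'`, with `+ 1` for the strict inequality.
    -- The generator `(0, 1)` of `C` provides the slack in weight.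
    let b : Additive N × ℤ :=
      (-.ofMul ⟨_, h⟩, weight ω (spell π') - weight ω (spell π) + 1)
    let C := AddSubmonoid.closure
      (Set.range (patternContribution ω π') ∪ {((0 : Additive N), (1 : ℤ))})
    have hC : IsLinearSet (b +ᵥ (C : Set (Additive N × ℤ))) :=
      ⟨b, _, (Set.finite_range _).union (Set.finite_singleton _), rfl⟩
    convert! hC.isSemilinearSet.preimage (totalContribution ω y π) using 1
    ext v
    have hmem : ∀ z : Additive N × ℤ, z ∈ C ↔
        ∃ x ∈ contributions ω π', ∃ t : ℕ, z = (x.1, x.2 + t) := by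
      intro z
      rw [show C = contributions ω π' ⊔ AddSubmonoid.closure {((0 : Additive N), (1 : ℤ))} from
        AddSubmonoid.closure_union _ _, AddSubmonoid.mem_sup]
      simp only [AddSubmonoid.mem_closure_singleton]
      constructor
      · rintro ⟨x, hx, _, ⟨t, rfl⟩, rfl⟩
        exact ⟨x, hx, t, by simp [Prod.ext_iff]⟩
      · rintro ⟨x, hx, t, rfl⟩
        exact ⟨x, hx, _, ⟨t, rfl⟩, by simp [Prod.ext_iff]⟩
    rw [Set.mem_preimage, Set.mem_vadd_set_iff_neg_vadd_mem, SetLike.mem_coe, hmem]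
    refine exists_congr fun x => and_congr_right fun hx => ?_
    rw [eval_patternedWord ω, weight_patternedWord]
    generalize totalContribution ω y π v = z
    have h₁ : (x.1.toMul : G) * eval (spell π') = z.1.toMul * eval (spell π) ↔
        x.1 = (-b + z).1 := by
      rw [← eq_mul_inv_iff_mul_eq, mul_assoc,
        show (z.1.toMul : G) * (eval (spell π) * (eval (spell π'))⁻¹) = _ from
          congrArg Subtype.val (mul_comm' z.1.toMul ⟨_, h⟩),
        ← Additive.toMul.injective.eq_iff,
        ← Subtype.coe_injective.eq_iff]
      simp [b]
    rw [h₁]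
    simp only [vadd_eq_add, Prod.ext_iff, b, Prod.snd_add, Prod.snd_neg]
    constructor
    · rintro ⟨h₁, h₂⟩
      exact ⟨(z.2 + weight ω (spell π) - x.2 - weight ω (spell π') - 1).toNat, h₁.symm, by omega⟩
    · rintro ⟨t, h₁, h₂⟩
      exact ⟨h₁.symm, by omega⟩
  -- Here `π` and `π'` end in different cosets, so the values never agree.
  · convert! IsSemilinearSet.empty using 1
    refine Set.eq_empty_of_forall_notMem fun v ⟨x, _, he, _⟩ => h ?_
    rw [eval_patternedWord ω, ← eq_mul_inv_iff_mul_eq, mul_assoc, ← inv_mul_eq_iff_eq_mul] at he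
    rw [← he]
    exact N.mul_mem (N.inv_mem (SetLike.coe_mem _)) (SetLike.coe_mem _)

/-- An improvement is realised by a patterned word; conversely, a lighter word with the same value
yields an improvement through `exists_pattern`. -/
theorem isGeodesic_patternedWord_iff [N.FiniteIndex] (ω : S → ℕ) {T : Set G}
    (hT : Subgroup.IsComplement (N : Set G) T) {m : ℕ} (y : Fin m ≃ wordsY S N)
    (π : List (wordsP S N)) (v : Fin ((π.length + 1) * m) → ℕ) :
    IsGeodesic ω (patternedWord y π v) ↔ ∀ π', IsPattern hT π' → v ∉ improvable ω y π π' := by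
  rw [isGeodesic_iff]
  constructor
  · rintro h π' - ⟨x, hx, he, hw⟩
    obtain ⟨u, rfl⟩ := exists_totalContribution_eq ω y π' hx
    rw [← eval_patternedWord] at he
    rw [← weight_patternedWord] at hw
    exact (h _ he).not_gt (by exact_mod_cast hw)
  · intro h τ hτ
    by_contra! hlt
    obtain ⟨π', hπ', x, hx, he, hw⟩ := exists_pattern ω hT τ
    exact h π' hπ' ⟨x, hx, by rw [← he, hτ], by rw [← hw]; exact_mod_cast hlt⟩

theorem isSemilinearSet_setOf_isGeodesic [N.FiniteIndex] (hS : S.Finite) (ω : S → ℕ) {T : Set G}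
    (hT : Subgroup.IsComplement (N : Set G) T) {m : ℕ} (y : Fin m ≃ wordsY S N)
    (π : List (wordsP S N)) :
    IsSemilinearSet {v | IsGeodesic ω (patternedWord y π v)} := by
  convert! (IsSemilinearSet.biUnion (finite_patterns hS hT) fun π' _ =>
    isSemilinearSet_improvable hS ω y π π').compl using 1
  ext v
  simp [isGeodesic_patternedWord_iff ω hT]

end Geodesics

end VirtAb

theorem mainTheorem5 {G : Type*} [Group G]
    -- the finite weighted monoid generating set
    (S : Set G) (hSfin : S.Finite) (hSgen : Submonoid.closure S = ⊤)
    (ω : S → ℕ) (hω : ∀ s, 0 < ω s)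
    -- the finite-index normal subgroup isomorphic to `ℤ^n` and its coset representatives
    (n : ℕ) (N : Subgroup G) [N.Normal] [N.FiniteIndex]
    (hN : Nonempty (N ≃* Multiplicative (Fin n → ℤ)))
    (T : Set G) (hT : Subgroup.IsComplement (N : Set G) T) (hT1 : (1 : G) ∈ T)
    -- the labelling of `Y`
    (m : ℕ) (y : Fin m ≃ VirtAb.wordsY S N)
    (π : List (VirtAb.wordsP S N)) (hπ : VirtAb.IsPattern hT π) :
    ∃ 𝒢 : Set (Fin ((π.length + 1) * m) → ℤ),
      VirtAb.IsPolyhedral 𝒢 ∧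
      𝒢 ⊆ VirtAb.natVectors ((π.length + 1) * m) ∧
      ∀ v : Fin ((π.length + 1) * m) → ℕ,
        (fun i => (v i : ℤ)) ∈ 𝒢 ↔
          VirtAb.IsGeodesic ω (VirtAb.patternedWord y π v) := by
  obtain ⟨φ⟩ := hN
  have : IsMulCommutative N :=
    .of_comm fun a b => φ.injective (by rw [map_mul, map_mul, mul_comm])
  have hgeo := VirtAb.isSemilinearSet_setOf_isGeodesic hSfin ω hT y π
  let c : (Fin ((π.length + 1) * m) → ℕ) →+ (Fin ((π.length + 1) * m) → ℤ) :=
    (Nat.castAddMonoidHom ℤ).compLeft _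
  have hc : Function.Injective c := fun u v huv =>
    funext fun i => Nat.cast_injective (R := ℤ) (congrFun huv i)
  -- Semilinearity passes to the image in `ℤ^r`; injectivity of `c` keeps membership unchanged.
  refine ⟨c '' {v | VirtAb.IsGeodesic ω (VirtAb.patternedWord y π v)},
    (hgeo.image c).isPolyhedral, ?_, fun v => ?_⟩
  · rintro _ ⟨v, -, rfl⟩ i
    exact Int.natCast_nonneg (v i)
  · exact hc.mem_set_image
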